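/- For $n\ge 0$ let $B_n$ be the set of signed permutations $\sigma=\sigma_1\sigma_2\cdots\sigma_n$ of $[n]=\{1,\dots,n\}$, that is, words of nonzero integers such that $|\sigma_1||\sigma_2|\cdots|\sigma_n|$ is a permutation of $[n]$. Let $D_n^B$ be the set of $\sigma\in B_n$ with $\sigma_i\neq i$ for all $i\in[n]$ (derangements of type $B$). An index $i\in[n]$ is a type $B$ excedance of $\sigma$ if $\sigma_i=-i$ or $\sigma_{|\sigma_i|}>\sigma_i$, and $\mathrm{exc}_B(\sigma)$ is the number of type $B$ excedances of $\sigma$. Let $$d_n^B(q)=\sum_{\sigma\in D_n^B}q^{\mathrm{exc}_B(\sigma)},$$ so that $d_0^B(q)=1$. Theorem. The polynomials $d_n^B(q)$ form a Sturm sequence: for every $n\ge 1$, $d_n^B(q)$ is a polynomial of degree $n$ with $n$ distinct real roots, all non-positive, and its roots are separated by the roots of $d_{n-1}^B(q)$. More precisely, if $r_{n,1}<r_{n,2}<\cdots<r_{n,n}$ are the roots of $d_n^B(q)$, then $r_{n,n}=0$ for all $n\ge1$, and for all $n\ge 2$ $$r_{n,1}<r_{n-1,1}<r_{n,2}<r_{n-1,2}<\cdots<r_{n-1,n-2}<r_{n,n-1}<r_{n-1,n-1}=r_{n,n}=0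 .$$ -/

import Mathlib

/-- Signed permutations of `[n] = {1, …, n}`: the word `σ₁ σ₂ ⋯ σₙ` of a permutation of `[n]`
in which some letters carry a minus sign. The element `i : Fin n` stands for `i + 1 ∈ [n]`;
`σ.1` is the underlying permutation `i ↦ |σ_i|`, and `σ.2 i` is the sign of the letter at
position `i`. -/
abbrev SignedPerm (n : ℕ) : Type := Equiv.Perm (Fin n) × (Fin n → ℤˣ)

namespace SignedPerm

/-- The letter `σ_i`, a nonzero integer in `[-n, n]`. -/
def letter {n : ℕ} (σ : SignedPerm n) (i : Fin n) : ℤ :=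
  (σ.2 i : ℤ) * (((σ.1 i : ℕ) : ℤ) + 1)

/-- The position `|σ_i| ∈ [n]`, as an element of `Fin n`, is `σ.1 i`. -/
theorem natAbs_letter {n : ℕ} (σ : SignedPerm n) (i : Fin n) :
    (σ.letter i).natAbs = (σ.1 i : ℕ) + 1 := by
  unfold letter
  rw [Int.natAbs_mul, Int.units_natAbs, one_mul]
  omega

/-- A derangement of type `B`: `σ_i ≠ i` for all `i ∈ [n]` (`σ_i = -i` is allowed). -/
def IsDerangement {n : ℕ} (σ : SignedPerm n) : Prop :=
  ∀ i : Fin n, σ.letter i ≠ ((i : ℕ) : ℤ) + 1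

/-- `i` is a type `B` excedance of `σ`: `σ_i = -i` or `σ_{|σ_i|} > σ_i`. -/
def IsExcedance {n : ℕ} (σ : SignedPerm n) (i : Fin n) : Prop :=
  σ.letter i = -(((i : ℕ) : ℤ) + 1) ∨ σ.letter (σ.1 i) > σ.letter i

instance {n : ℕ} (σ : SignedPerm n) : Decidable σ.IsDerangement :=
  inferInstanceAs (Decidable (∀ i : Fin n, σ.letter i ≠ ((i : ℕ) : ℤ) + 1))

instance {n : ℕ} (σ : SignedPerm n) (i : Fin n) : Decidable (σ.IsExcedance i) :=
  inferInstanceAs (Decidable (σ.letter i = -(((i : ℕ) : ℤ) + 1) ∨ σ.letter (σ.1 i) > σ.letter i))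

/-- `exc_B(σ)`, the number of type `B` excedances of `σ`. -/
def exc {n : ℕ} (σ : SignedPerm n) : ℕ :=
  (Finset.univ.filter fun i : Fin n => σ.IsExcedance i).card

end SignedPerm

/-- The type `B` derangement polynomial `d_n^B(q)`, the sum of `q ^ exc_B(σ)` over the type `B`
derangements `σ` on `[n]`, with real coefficients. For `n = 0` the only summand is that of the
empty word, so `d_0^B(q) = 1`. -/
noncomputable def derangementPolyB (n : ℕ) : Polynomial ℝ :=
  ∑ σ ∈ Finset.univ.filter (fun σ : SignedPerm n => σ.IsDerangement), Polynomial.X ^ σ.exc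

/-- The value at `n = 0` is the conventional one. -/
theorem derangementPolyB_zero : derangementPolyB 0 = 1 := by
  have h : Finset.univ.filter (fun σ : SignedPerm 0 => σ.IsDerangement) = {default} := by decide
  have h' : (default : SignedPerm 0).exc = 0 := by decide
  rw [derangementPolyB, h, Finset.sum_singleton, h', pow_zero]

/-! Every signed permutation of `[n+1]` arises uniquely from one of `[n]` by adding `±(n+1)`, either
as a cycle of its own (`append`) or after some letter in a cycle (`insertAfter`). An excedance is an
ascent between cyclically consecutive letters, or a negative one-letter cycle, so `exc_insertAfter`
and `fix_insertAfter` give a recurrence for the excedance polynomials refined by fixed points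
(`fixPoly_succ_eq`). Eliminating the polynomial for one fixed point by `succ_mul_fixPoly` leaves a
three-term recurrence for `d_n^B` (`derangementPolyB_add_two`).

Write `d_{m+1}^B = X e_m`. At a root `s` of `e_{m+1}` the recurrence reads `e_{m+2}(s) = 2s((1-s)
e_{m+1}'(s) + (m+2) e_m(s))`. By simplicity of the roots and interlacing, the two summands have the
same sign, alternating along the roots. With the signs of `e_{m+2}` near `-∞` and at `0`, the
intermediate value theorem gives `m+2` negative roots interlacing those of `e_{m+1}`
(`IsRootList.exists_succ`). -/

open Polynomial

/-! ### Insertion of a letter: effect on excedances and fixed points -/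

namespace SignedPerm

theorem abs_letter_lt {n : ℕ} (σ : SignedPerm n) (i : Fin n) :
    -((n : ℤ) + 1) < σ.letter i ∧ σ.letter i < (n : ℤ) + 1 := by
  have := natAbs_letter σ i
  have := (σ.1 i).isLt
  omega

/-- `i` is a fixed point of the signed permutation. -/
def IsFixed {n : ℕ} (σ : SignedPerm n) (i : Fin n) : Prop :=
  σ.letter i = ((i : ℕ) : ℤ) + 1

instance {n : ℕ} (σ : SignedPerm n) (i : Fin n) : Decidable (σ.IsFixed i) :=
  inferInstanceAs (Decidable (σ.letter i = ((i : ℕ) : ℤ) + 1))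

theorem apply_eq_of_letter {n : ℕ} (σ : SignedPerm n) (i k : Fin n)
    (h : (σ.letter i).natAbs = (k : ℕ) + 1) : σ.1 i = k := by
  have := natAbs_letter σ i
  exact Fin.ext (by omega)

theorem IsFixed.apply_eq {n : ℕ} {σ : SignedPerm n} {i : Fin n} (h : σ.IsFixed i) : σ.1 i = i :=
  apply_eq_of_letter σ i i (by unfold IsFixed at h; omega)

theorem IsFixed.not_isExcedance {n : ℕ} {σ : SignedPerm n} {i : Fin n} (h : σ.IsFixed i) :
    ¬ σ.IsExcedance i := by
  unfold IsExcedance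
  rw [h.apply_eq]
  unfold IsFixed at h
  omega

/-- The number of fixed points. -/
def fix {n : ℕ} (σ : SignedPerm n) : ℕ :=
  (Finset.univ.filter fun i : Fin n => σ.IsFixed i).card

theorem exc_eq_sum {n : ℕ} (σ : SignedPerm n) :
    σ.exc = ∑ i, if σ.IsExcedance i then 1 else 0 := by
  rw [exc, Finset.card_filter]

theorem fix_eq_sum {n : ℕ} (σ : SignedPerm n) :
    σ.fix = ∑ i, if σ.IsFixed i then 1 else 0 := by
  rw [fix, Finset.card_filter]

theorem isDerangement_iff_fix {n : ℕ} (σ : SignedPerm n) : σ.IsDerangement ↔ σ.fix = 0 := by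
  unfold IsDerangement fix
  rw [Finset.card_eq_zero, Finset.filter_eq_empty_iff]
  simp [IsFixed]

/-- Append the letter `ε (n + 1)` at the end of the word. -/
def append {n : ℕ} (σ : SignedPerm n) (ε : ℤˣ) : SignedPerm (n + 1) :=
  (finSuccEquivLast.symm.permCongr (Equiv.optionCongr σ.1), Fin.snoc (α := fun _ => ℤˣ) σ.2 ε)

@[simp] theorem append_fst_castSucc {n : ℕ} (σ : SignedPerm n) (ε : ℤˣ) (i : Fin n) :
    (σ.append ε).1 i.castSucc = (σ.1 i).castSucc := by
  simp [append, Equiv.permCongr_apply]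

@[simp] theorem append_fst_last {n : ℕ} (σ : SignedPerm n) (ε : ℤˣ) :
    (σ.append ε).1 (Fin.last n) = Fin.last n := by
  simp [append, Equiv.permCongr_apply]

@[simp] theorem append_letter_castSucc {n : ℕ} (σ : SignedPerm n) (ε : ℤˣ) (i : Fin n) :
    (σ.append ε).letter i.castSucc = σ.letter i := by
  unfold letter
  rw [append_fst_castSucc]
  simp [append]

@[simp] theorem append_letter_last {n : ℕ} (σ : SignedPerm n) (ε : ℤˣ) :
    (σ.append ε).letter (Fin.last n) = ε * ((n : ℤ) + 1) := by
  unfold letter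
  rw [append_fst_last]
  simp [append]

/-- Permute the positions of the letters. -/
def comp {n : ℕ} (σ : SignedPerm n) (g : Equiv.Perm (Fin n)) : SignedPerm n :=
  (σ.1 * g, σ.2 ∘ g)

@[simp] theorem comp_fst {n : ℕ} (σ : SignedPerm n) (g : Equiv.Perm (Fin n)) (i : Fin n) :
    (σ.comp g).1 i = σ.1 (g i) := rfl

@[simp] theorem comp_letter {n : ℕ} (σ : SignedPerm n) (g : Equiv.Perm (Fin n)) (i : Fin n) :
    (σ.comp g).letter i = σ.letter (g i) := rfl

/-- Insert the letter `ε (n + 1)` at position `j`, moving the letter there to the end. In terms of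
cycles of letters, the new letter is inserted between two consecutive letters. -/
def insertAt {n : ℕ} (x : (SignedPerm n × ℤˣ) × Fin (n + 1)) : SignedPerm (n + 1) :=
  (x.1.1.append x.1.2).comp (Equiv.swap x.2 (Fin.last n))

theorem append_injective {n : ℕ} :
    Function.Injective fun x : SignedPerm n × ℤˣ => x.1.append x.2 := by
  rintro ⟨⟨p, s⟩, ε⟩ ⟨⟨p', s'⟩, ε'⟩ h
  simp only [append, Prod.mk.injEq] at h
  obtain ⟨h1, h2⟩ := h
  have h1 := finSuccEquivLast.symm.permCongr.injective h1
  have h1 := Equiv.optionCongr_injective h1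
  obtain ⟨h2, h3⟩ := Fin.snoc_injective2 h2
  subst h1 h2 h3
  rfl

theorem insertAt_bijective {n : ℕ} : Function.Bijective (insertAt (n := n)) := by
  rw [Fintype.bijective_iff_injective_and_card]
  constructor
  · rintro ⟨⟨σ, ε⟩, j⟩ ⟨⟨σ', ε'⟩, j'⟩ h
    have hj : j = j' := by
      have h1 : (insertAt ((σ, ε), j)).1 j = Fin.last n := by simp [insertAt]
      have h2 : (insertAt ((σ', ε'), j')).1 j' = Fin.last n := by simp [insertAt]
      rw [h, ← h2] at h1
      exact (insertAt ((σ', ε'), j')).1.injective h1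
    subst hj
    have h3 : σ.append ε = σ'.append ε' := by
      unfold insertAt comp at h
      simp only [Prod.mk.injEq, mul_left_inj] at h
      exact Prod.ext h.1 ((Equiv.swap j (Fin.last n)).surjective.injective_comp_right h.2)
    exact Prod.ext (append_injective (a₁ := (σ, ε)) (a₂ := (σ', ε')) h3) rfl
  · simp [Fintype.card_perm, Nat.factorial_succ, Fintype.card_units_int, pow_succ]
    ring

theorem exc_append {n : ℕ} (σ : SignedPerm n) (ε : ℤˣ) :
    (σ.append ε).exc = σ.exc + if ε = 1 then 0 else 1 := by
  rw [exc_eq_sum, exc_eq_sum, Fin.sum_univ_castSucc]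
  congr 1
  · simp [IsExcedance]
  · rcases Int.units_eq_one_or ε with rfl | rfl <;> simp [IsExcedance]
    omega

theorem fix_append {n : ℕ} (σ : SignedPerm n) (ε : ℤˣ) :
    (σ.append ε).fix = σ.fix + if ε = 1 then 1 else 0 := by
  rw [fix_eq_sum, fix_eq_sum, Fin.sum_univ_castSucc]
  congr 1
  · exact Finset.sum_congr rfl fun i _ => if_congr (by simp [IsFixed]) rfl rfl
  · rcases Int.units_eq_one_or ε with rfl | rfl <;> simp [IsFixed]
    omega

/-- Insertion of a letter after the letter at position `i`. -/
def insertAfter {n : ℕ} (σ : SignedPerm n) (ε : ℤˣ) (i : Fin n) : SignedPerm (n + 1) :=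
  (σ.append ε).comp (Equiv.swap (σ.1 i).castSucc (Fin.last n))

theorem letter_insertAfter_last {n : ℕ} (σ : SignedPerm n) (ε : ℤˣ) (i : Fin n) :
    (σ.insertAfter ε i).letter (Fin.last n) = σ.letter (σ.1 i) := by
  simp [insertAfter]

theorem letter_insertAfter_apply {n : ℕ} (σ : SignedPerm n) (ε : ℤˣ) (i : Fin n) :
    (σ.insertAfter ε i).letter (σ.1 i).castSucc = ε * ((n : ℤ) + 1) := by
  simp [insertAfter]

theorem letter_insertAfter_of_ne {n : ℕ} (σ : SignedPerm n) (ε : ℤˣ) (i k : Fin n)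
    (h : k ≠ σ.1 i) : (σ.insertAfter ε i).letter k.castSucc = σ.letter k := by
  have h1 : k.castSucc ≠ (σ.1 i).castSucc := by simpa using h
  have h2 : k.castSucc ≠ Fin.last n := Fin.castSucc_ne_last k
  simp [insertAfter, Equiv.swap_apply_of_ne_of_ne h1 h2]

theorem fst_insertAfter_last {n : ℕ} (σ : SignedPerm n) (ε : ℤˣ) (i : Fin n) :
    (σ.insertAfter ε i).1 (Fin.last n) = (σ.1 (σ.1 i)).castSucc := by
  simp [insertAfter]

theorem fst_insertAfter_apply {n : ℕ} (σ : SignedPerm n) (ε : ℤˣ) (i : Fin n) :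
    (σ.insertAfter ε i).1 (σ.1 i).castSucc = Fin.last n := by
  simp [insertAfter]

theorem fst_insertAfter_of_ne {n : ℕ} (σ : SignedPerm n) (ε : ℤˣ) (i k : Fin n)
    (h : k ≠ σ.1 i) : (σ.insertAfter ε i).1 k.castSucc = (σ.1 k).castSucc := by
  have h1 : k.castSucc ≠ (σ.1 i).castSucc := by simpa using h
  have h2 : k.castSucc ≠ Fin.last n := Fin.castSucc_ne_last k
  simp [insertAfter, Equiv.swap_apply_of_ne_of_ne h1 h2]

theorem fix_insertAfter {n : ℕ} (σ : SignedPerm n) (ε : ℤˣ) (i : Fin n) :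
    (σ.insertAfter ε i).fix + (if σ.IsFixed i then 1 else 0) = σ.fix := by
  have hlast : ¬ (σ.insertAfter ε i).IsFixed (Fin.last n) := by
    unfold IsFixed
    rw [letter_insertAfter_last]
    have := abs_letter_lt σ (σ.1 i)
    simp only [Fin.val_last]
    omega
  have happly : ¬ (σ.insertAfter ε i).IsFixed (σ.1 i).castSucc := by
    intro h
    have h1 := h.apply_eq
    rw [fst_insertAfter_apply] at h1
    exact Fin.castSucc_ne_last _ h1.symm
  have hfix : σ.IsFixed i ↔ σ.IsFixed (σ.1 i) := by
    constructor
    · intro h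
      rwa [h.apply_eq]
    · intro h
      have h1 : σ.1 i = i := σ.1.injective h.apply_eq
      rwa [h1] at h
  rw [fix_eq_sum, fix_eq_sum, Fin.sum_univ_castSucc, if_neg hlast, add_zero,
    ← Finset.add_sum_erase _ _ (Finset.mem_univ (σ.1 i)),
    ← Finset.add_sum_erase _ _ (Finset.mem_univ (σ.1 i)), if_neg happly, zero_add, add_comm,
    ← if_congr hfix rfl rfl]
  congr 1
  refine Finset.sum_congr rfl fun k hk => ?_
  exact if_congr (by simp [IsFixed, letter_insertAfter_of_ne σ ε i k (Finset.ne_of_mem_erase hk)])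
    rfl rfl

/-- The new letter is larger or smaller than all others, so exactly one of the comparisons with its
two cyclic neighbours is an ascent, whichever sign it has. Those two comparisons replace the single
one at `i`. -/
theorem exc_insertAfter {n : ℕ} (σ : SignedPerm n) (ε : ℤˣ) (i : Fin n) :
    (σ.insertAfter ε i).exc + (if σ.IsExcedance i then 1 else 0) = σ.exc + 1 := by
  set τ := σ.insertAfter ε i with hτ
  have hother : ∀ k : Fin n, k ≠ σ.1 i → k ≠ i →
      (τ.IsExcedance k.castSucc ↔ σ.IsExcedance k) := by
    intro k h1 h2
    unfold IsExcedance
    rw [hτ, fst_insertAfter_of_ne σ ε i k h1, letter_insertAfter_of_ne σ ε i k h1,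
      letter_insertAfter_of_ne σ ε i (σ.1 k) (fun h => h2 (σ.1.injective h))]
    simp
  have hε : (ε : ℤ) * ((n : ℤ) + 1) = n + 1 ∨ (ε : ℤ) * ((n : ℤ) + 1) = -(n + 1) := by
    rcases Int.units_eq_one_or ε with rfl | rfl <;> simp
  have hlet := abs_letter_lt σ
  rw [exc_eq_sum, exc_eq_sum, Fin.sum_univ_castSucc]
  -- A one-letter cycle becomes a two-letter cycle, which has exactly one ascent; here the clause
  -- `σ_i = -i` decides the old count.
  by_cases hi : σ.1 i = i
  · have e1 : τ.IsExcedance i.castSucc ↔ σ.letter i > ε * ((n : ℤ) + 1) := by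
      have h1 := fst_insertAfter_apply σ ε i
      have h2 := letter_insertAfter_apply σ ε i
      have h3 := letter_insertAfter_last σ ε i
      rw [hi] at h1 h2 h3
      unfold IsExcedance
      rw [h1, h2, h3]
      have := i.isLt
      simp only [Fin.val_castSucc]
      omega
    have e2 : τ.IsExcedance (Fin.last n) ↔ ε * ((n : ℤ) + 1) > σ.letter i := by
      have h1 := fst_insertAfter_last σ ε i
      have h2 := letter_insertAfter_apply σ ε i
      have h3 := letter_insertAfter_last σ ε i
      rw [hi] at h2 h3
      rw [hi, hi] at h1
      unfold IsExcedance
      rw [h1, h2, h3]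
      have := hlet i
      simp only [Fin.val_last]
      omega
    rw [← Finset.add_sum_erase _ _ (Finset.mem_univ i),
      ← Finset.add_sum_erase (Finset.univ) (fun k => if σ.IsExcedance k then 1 else 0)
        (Finset.mem_univ i)]
    have hs : ∑ k ∈ Finset.univ.erase i, (if τ.IsExcedance k.castSucc then 1 else 0) =
        ∑ k ∈ Finset.univ.erase i, if σ.IsExcedance k then 1 else 0 := by
      refine Finset.sum_congr rfl fun k hk => ?_
      have hk := Finset.ne_of_mem_erase hk
      exact if_congr (hother k (by rwa [hi]) hk) rfl rfl
    rw [hs, if_congr e1 rfl rfl, if_congr e2 rfl rfl]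
    have := hlet i
    split_ifs <;> omega
  · have e1 : τ.IsExcedance (σ.1 i).castSucc ↔ σ.letter (σ.1 i) > ε * ((n : ℤ) + 1) := by
      unfold IsExcedance
      rw [hτ, fst_insertAfter_apply, letter_insertAfter_apply, letter_insertAfter_last]
      have := (σ.1 i).isLt
      simp only [Fin.val_castSucc]
      omega
    -- The letter formerly at position `|σ_i|` now stands at the end, and its successor in the cycle
    -- has the same value as before.
    have e2 : τ.IsExcedance (Fin.last n) ↔ σ.IsExcedance (σ.1 i) := by
      unfold IsExcedance
      have h3 : σ.letter (σ.1 i) ≠ -(((σ.1 i : ℕ) : ℤ) + 1) := by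
        intro h
        exact hi (σ.1.injective (apply_eq_of_letter σ (σ.1 i) (σ.1 i) (by omega)))
      have h4 : σ.1 (σ.1 i) ≠ σ.1 i := fun h => hi (σ.1.injective h)
      rw [hτ, fst_insertAfter_last, letter_insertAfter_last, letter_insertAfter_of_ne _ _ _ _ h4]
      have := hlet (σ.1 i)
      simp only [Fin.val_last]
      omega
    have e3 : τ.IsExcedance i.castSucc ↔ ε * ((n : ℤ) + 1) > σ.letter i := by
      unfold IsExcedance
      have h3 : σ.letter i ≠ -(((i : ℕ) : ℤ) + 1) := by
        intro h
        exact hi (apply_eq_of_letter σ i i (by omega))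
      rw [hτ, fst_insertAfter_of_ne _ _ _ _ (Ne.symm hi), letter_insertAfter_apply,
        letter_insertAfter_of_ne _ _ _ _ (Ne.symm hi)]
      simp only [Fin.val_castSucc]
      tauto
    have hm : i ∈ Finset.univ.erase (σ.1 i) :=
      Finset.mem_erase.2 ⟨Ne.symm hi, Finset.mem_univ i⟩
    rw [← Finset.add_sum_erase _ _ (Finset.mem_univ (σ.1 i)),
      ← Finset.add_sum_erase (Finset.univ) (fun k => if σ.IsExcedance k then 1 else 0)
        (Finset.mem_univ (σ.1 i)), ← Finset.add_sum_erase _ _ hm,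
      ← Finset.add_sum_erase _ (fun k => if σ.IsExcedance k then 1 else 0) hm]
    have hs : ∑ k ∈ (Finset.univ.erase (σ.1 i)).erase i,
        (if τ.IsExcedance k.castSucc then 1 else 0) =
        ∑ k ∈ (Finset.univ.erase (σ.1 i)).erase i, if σ.IsExcedance k then 1 else 0 := by
      refine Finset.sum_congr rfl fun k hk => ?_
      have hk1 := Finset.ne_of_mem_erase hk
      have hk2 := Finset.ne_of_mem_erase (Finset.mem_of_mem_erase hk)
      exact if_congr (hother k hk2 hk1) rfl rfl
    rw [hs, if_congr e1 rfl rfl, if_congr e2 rfl rfl, if_congr e3 rfl rfl]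
    have := hlet i
    have := hlet (σ.1 i)
    split_ifs <;> omega

end SignedPerm

/-! ### Recurrences for the excedance polynomials -/

namespace SignedPerm

theorem sum_succ {n : ℕ} (F : SignedPerm (n + 1) → ℝ[X]) :
    ∑ τ, F τ = ∑ σ : SignedPerm n, ∑ ε : ℤˣ, (F (σ.append ε) + ∑ i, F (σ.insertAfter ε i)) := by
  rw [← insertAt_bijective.sum_comp, Fintype.sum_prod_type, Fintype.sum_prod_type]
  refine Finset.sum_congr rfl fun σ _ => Finset.sum_congr rfl fun ε _ => ?_
  rw [Fin.sum_univ_castSucc, add_comm]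
  congr 1
  · simp only [insertAt, Equiv.swap_self]
    rfl
  -- Insertion at position `j` is insertion after the letter at `i` when `j = |σ_i|`.
  · exact (Equiv.sum_comp σ.1 fun j => F (insertAt ((σ, ε), j.castSucc))).symm

/-- The excedance enumerator of the signed permutations with `f` fixed points. -/
noncomputable def fixPoly (n f : ℕ) : ℝ[X] :=
  ∑ σ : SignedPerm n, if σ.fix = f then X ^ σ.exc else 0

theorem fixPoly_zero_right (n : ℕ) : fixPoly n 0 = derangementPolyB n := by
  rw [fixPoly, derangementPolyB, Finset.sum_filter]
  exact Finset.sum_congr rfl fun σ _ => if_congr (isDerangement_iff_fix σ).symm rfl rfl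

theorem fixPoly_zero_left (f : ℕ) : fixPoly 0 f = if f = 0 then 1 else 0 := by
  have h1 : ∀ σ : SignedPerm 0, σ.fix = 0 := by decide
  have h2 : ∀ σ : SignedPerm 0, σ.exc = 0 := by decide
  simp only [fixPoly, h1, h2, pow_zero]
  simp [eq_comm]

/-- The contribution of the insertions into the cycles of `σ`. -/
theorem sum_insertAfter {n : ℕ} (σ : SignedPerm n) (ε : ℤˣ) (f : ℕ) :
    (∑ i, if (σ.insertAfter ε i).fix = f then (X : ℝ[X]) ^ (σ.insertAfter ε i).exc else 0) =
      (if σ.fix = f then (X * (1 - X) * derivative (X ^ σ.exc) + ((n : ℝ[X]) - (f : ℝ[X])) * X * X ^ σ.exc)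
        else 0) + if σ.fix = f + 1 then ((f : ℝ[X]) + 1) * X * X ^ σ.exc else 0 := by
  have hterm : ∀ i, (if (σ.insertAfter ε i).fix = f
      then (X : ℝ[X]) ^ (σ.insertAfter ε i).exc else 0) =
      (if σ.fix = f then X ^ (σ.exc + 1) else 0) +
      (if σ.IsExcedance i then (if σ.fix = f then X ^ σ.exc - X ^ (σ.exc + 1) else 0) else 0) +
      (if σ.IsFixed i then ((if σ.fix = f + 1 then X ^ (σ.exc + 1) else 0) -
        (if σ.fix = f then X ^ (σ.exc + 1) else 0)) else 0) := by
    intro i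
    have h1 := exc_insertAfter σ ε i
    have h2 := fix_insertAfter σ ε i
    by_cases hF : σ.IsFixed i
    · have hE := hF.not_isExcedance
      rw [if_pos hF] at h2
      rw [if_neg hE] at h1
      rw [if_pos hF, if_neg hE, ← h2]
      simp only [Nat.add_right_cancel_iff]
      rw [show (σ.insertAfter ε i).exc = σ.exc + 1 from h1]
      ring
    · rw [if_neg hF, add_zero] at h2
      rw [if_neg hF, h2]
      by_cases hE : σ.IsExcedance i
      · rw [if_pos hE] at h1 ⊢
        rw [show (σ.insertAfter ε i).exc = σ.exc by omega]
        split_ifs <;> ring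
      · rw [if_neg hE] at h1 ⊢
        rw [show (σ.insertAfter ε i).exc = σ.exc + 1 from h1]
        ring
  -- Turns the number of excedances, that is, of insertions preserving `exc`, into a derivative.
  have hder : (X : ℝ[X]) * derivative (X ^ σ.exc) = (σ.exc : ℝ[X]) * X ^ σ.exc := by
    rw [derivative_X_pow]
    rcases σ.exc with _ | k
    · simp
    · simp only [Nat.add_sub_cancel, map_natCast]
      ring
  simp only [hterm, Finset.sum_add_distrib]
  have hexc : ∀ c : ℝ[X], ∑ i, (if σ.IsExcedance i then c else 0) = σ.exc * c := fun c => by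
    rw [← Finset.sum_filter, Finset.sum_const, nsmul_eq_mul, exc]
  have hfix : ∀ c : ℝ[X], ∑ i, (if σ.IsFixed i then c else 0) = σ.fix * c := fun c => by
    rw [← Finset.sum_filter, Finset.sum_const, nsmul_eq_mul, fix]
  rw [hexc, hfix, Finset.sum_const, Finset.card_univ, Fintype.card_fin, nsmul_eq_mul]
  by_cases h : σ.fix = f
  · rw [if_pos h, if_pos h, if_pos h, if_neg (by omega), if_neg (by omega), h]
    linear_combination (X - 1) * hder
  · rw [if_neg h, if_neg h, if_neg h]
    by_cases h' : σ.fix = f + 1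
    · rw [if_pos h', if_pos h', h']
      push_cast
      ring
    · rw [if_neg h', if_neg h']
      ring

theorem sum_units_int (F : ℤˣ → ℝ[X]) : ∑ ε, F ε = F 1 + F (-1) := by
  rw [show (Finset.univ : Finset ℤˣ) = {1, -1} by decide, Finset.sum_pair (by decide)]

/-- The first two terms come from appending `n+1` and `-(n+1)`, the others from insertion into a
cycle. There the factor `2` counts the signs, and the last term the insertions that destroy one of
`f+1` fixed points. -/
theorem fixPoly_succ_eq (n f : ℕ) : fixPoly (n + 1) f =
    (∑ σ : SignedPerm n, if σ.fix + 1 = f then X ^ σ.exc else 0) + X * fixPoly n f +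
      2 * X * (1 - X) * derivative (fixPoly n f) + 2 * ((n : ℝ[X]) - (f : ℝ[X])) * X * fixPoly n f +
      2 * ((f : ℝ[X]) + 1) * X * fixPoly n (f + 1) := by
  have hd : derivative (fixPoly n f) =
      ∑ σ : SignedPerm n, if σ.fix = f then derivative (X ^ σ.exc) else 0 := by
    rw [fixPoly, derivative_sum]
    refine Finset.sum_congr rfl fun σ _ => ?_
    split_ifs <;> simp
  rw [hd]
  rw [fixPoly, sum_succ]
  simp only [fixPoly, Finset.mul_sum, ← Finset.sum_add_distrib]
  refine Finset.sum_congr rfl fun σ _ => ?_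
  simp only [sum_insertAfter, sum_units_int, fix_append, exc_append,
    (by decide : (-1 : ℤˣ) ≠ 1), if_true, if_false, add_zero]
  split_ifs <;> ring

/-- Combinatorially, both sides count signed permutations with a marked fixed point, whose removal
does not change `exc`. The proof instead checks by induction on `n` that both sides obey the same
recurrence. -/
theorem succ_mul_fixPoly (n : ℕ) : ∀ f : ℕ,
    ((f : ℝ[X]) + 1) * fixPoly (n + 1) (f + 1) = ((n : ℝ[X]) + 1) * fixPoly n f := by
  have hs : ∀ n f : ℕ, (∑ σ : SignedPerm n, if σ.fix + 1 = f + 1 then (X : ℝ[X]) ^ σ.exc else 0) =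
      fixPoly n f := fun n f => by simp only [fixPoly, Nat.add_right_cancel_iff]
  have hz : ∀ n : ℕ, (∑ σ : SignedPerm n, if σ.fix + 1 = 0 then (X : ℝ[X]) ^ σ.exc else 0) = 0 :=
    fun n => by simp
  induction n with
  | zero =>
    intro f
    rw [fixPoly_succ_eq, hs]
    simp only [fixPoly_zero_left]
    by_cases hf : f = 0 <;> simp [hf]
  | succ n ih =>
    intro f
    have e1 := ih f
    have e2 := ih (f + 1)
    have e3 := congrArg derivative e1
    have hc : ∀ k : ℕ, (k : ℝ[X]) + 1 = C ((k : ℝ) + 1) := fun k => by simp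
    rw [hc, hc, derivative_C_mul, derivative_C_mul, ← hc, ← hc] at e3
    have h1 := fixPoly_succ_eq (n + 1) (f + 1)
    rw [hs] at h1
    rcases f with _ | f
    · have h2 := fixPoly_succ_eq n 0
      rw [hz] at h2
      push_cast at *
      linear_combination h1 - ((n : ℝ[X]) + 1) * h2 + (X + 2 * (n : ℝ[X]) * X) * e1 +
        2 * X * (1 - X) * e3 + 2 * X * e2
    · have h2 := fixPoly_succ_eq n (f + 1)
      rw [hs] at h2
      have e0 := ih f
      push_cast at *
      linear_combination ((f : ℝ[X]) + 2) * h1 - ((n : ℝ[X]) + 1) * h2 +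
        (X + 2 * ((n : ℝ[X]) - (f + 1)) * X) * e1 +
        2 * X * (1 - X) * e3 + 2 * ((f : ℝ[X]) + 2) * X * e2 + e0

end SignedPerm

open SignedPerm in
theorem derangementPolyB_one : derangementPolyB 1 = X := by
  have h := fixPoly_succ_eq 0 0
  simpa [fixPoly_zero_left, fixPoly_zero_right, derangementPolyB_zero] using h

open SignedPerm in
theorem derangementPolyB_add_two (n : ℕ) : derangementPolyB (n + 2) =
    (2 * (n : ℝ[X]) + 3) * X * derangementPolyB (n + 1) +
      2 * X * (1 - X) * derivative (derangementPolyB (n + 1)) +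
      2 * ((n : ℝ[X]) + 1) * X * derangementPolyB n := by
  have h := fixPoly_succ_eq (n + 1) 0
  have h1 := succ_mul_fixPoly n 0
  simp only [fixPoly_zero_right, Nat.add_eq_zero_iff, one_ne_zero, and_false, if_false,
    Finset.sum_const_zero] at h h1
  push_cast at h h1
  linear_combination h + 2 * X * h1

/-! ### Signs of real polynomials and location of roots -/

theorem pos_neg_one_pow_mul_prod_sub {n : ℕ} (s : Fin n → ℝ) (x : ℝ) (k : ℕ) (hk : k ≤ n)
    (h1 : ∀ j : Fin n, (j : ℕ) < k → s j < x) (h2 : ∀ j : Fin n, k ≤ (j : ℕ) → x < s j) :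
    0 < (-1 : ℝ) ^ (n - k) * ∏ j, (x - s j) := by
  induction n generalizing k with
  | zero => simp
  | succ n ih =>
    rw [Fin.prod_univ_castSucc]
    rcases Nat.lt_or_ge n k with h | h
    · have hkn : k = n + 1 := by omega
      subst hkn
      have := ih (fun j => s j.castSucc) n le_rfl (fun j hj => h1 _ (by simp))
        (fun j hj => absurd j.isLt (by omega))
      have hl := h1 (Fin.last n) (by simp)
      simp only [Nat.sub_self, pow_zero, one_mul] at this ⊢
      exact mul_pos this (sub_pos.2 hl)
    · have := ih (fun j => s j.castSucc) k h (fun j hj => h1 _ (by simpa using hj))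
        (fun j hj => h2 _ (by simpa using hj))
      have hl := h2 (Fin.last n) (by simpa using h)
      rw [Nat.succ_sub h, pow_succ]
      have := mul_pos this (sub_pos.2 hl)
      linarith

theorem pos_neg_one_pow_mul_derivative {m : ℕ} (s : Fin (m + 1) → ℝ) (hs : StrictMono s)
    (i : Fin (m + 1)) :
    0 < (-1 : ℝ) ^ (m - i) * (derivative (∏ j, (X - C (s j)))).eval (s i) := by
  rw [Fin.prod_univ_succAbove _ i, derivative_mul]
  simp only [derivative_sub, derivative_X, derivative_C, eval_add, eval_mul, eval_sub, eval_X,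
    eval_C, sub_self, zero_mul, add_zero, sub_zero, one_mul, eval_prod]
  refine pos_neg_one_pow_mul_prod_sub (fun j => s (i.succAbove j)) (s i) i (by omega) ?_ ?_
  · intro j hj
    exact hs (by rw [Fin.succAbove_of_castSucc_lt _ _ hj]; exact hj)
  · intro j hj
    exact hs (by
      rw [Fin.succAbove_of_le_castSucc _ _ hj]; exact Fin.lt_def.2 (by simp; omega))

theorem eq_prod_of_roots {n : ℕ} {f : ℝ[X]} (hf : f.Monic) (hn : f.natDegree = n)
    (t : Fin n → ℝ) (ht : Function.Injective t) (hr : ∀ j, f.IsRoot (t j)) :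
    f = ∏ j, (X - C (t j)) := by
  have hd : ∏ j, (X - C (t j)) ∣ f :=
    Finset.prod_dvd_of_coprime
      (fun i _ j _ hij => pairwise_coprime_X_sub_C ht hij) (fun j _ => dvd_iff_isRoot.2 (hr j))
  refine eq_of_monic_of_dvd_of_natDegree_le (monic_prod_X_sub_C t _) hf hd ?_
  rw [hn, natDegree_finsetProd_X_sub_C_eq_card]
  simp

/-- The intermediate value theorem gives a root in each of the `n` gaps, and the degree leaves room
for no others. -/
theorem exists_roots_of_alternating {n : ℕ} {f : ℝ[X]} (hf : f.Monic) (hn : f.natDegree = n)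
    (u : Fin (n + 1) → ℝ) (hu : StrictMono u)
    (hsign : ∀ k : Fin (n + 1), 0 < (-1 : ℝ) ^ (n - k) * f.eval (u k)) :
    ∃ t : Fin n → ℝ, StrictMono t ∧ f = ∏ j, (X - C (t j)) ∧
      ∀ j, u j.castSucc < t j ∧ t j < u j.succ := by
  have hex : ∀ j : Fin n, ∃ x, f.IsRoot x ∧ u j.castSucc < x ∧ x < u j.succ := by
    intro j
    have hlt : u j.castSucc < u j.succ := hu Fin.castSucc_lt_succ
    have h1 := hsign j.castSucc
    have h2 := hsign j.succ
    have hexp : n - (j.castSucc : ℕ) = (n - (j.succ : ℕ)) + 1 := by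
      simp only [Fin.val_castSucc, Fin.val_succ]; omega
    rw [hexp, pow_succ] at h1
    rcases neg_one_pow_eq_or ℝ (n - (j.succ : ℕ)) with h | h <;> rw [h] at h1 h2
    · obtain ⟨x, hx, hx0⟩ := intermediate_value_Ioo hlt.le f.continuous.continuousOn
        (show (0 : ℝ) ∈ Set.Ioo _ _ from ⟨by linarith, by linarith⟩)
      exact ⟨x, hx0, hx.1, hx.2⟩
    · obtain ⟨x, hx, hx0⟩ := intermediate_value_Ioo' hlt.le f.continuous.continuousOn
        (show (0 : ℝ) ∈ Set.Ioo _ _ from ⟨by linarith, by linarith⟩)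
      exact ⟨x, hx0, hx.1, hx.2⟩
  choose t ht0 ht1 ht2 using hex
  have hmono : StrictMono t := fun i j hij =>
    (ht2 i).trans_le ((hu.monotone (by
      rw [Fin.le_def]; simp only [Fin.val_succ, Fin.val_castSucc]; exact hij)).trans (ht1 j).le)
  exact ⟨t, hmono, eq_prod_of_roots hf hn t hmono.injective ht0, fun j => ⟨ht1 j, ht2 j⟩⟩

theorem exists_lt_pos_neg_one_pow {f : ℝ[X]} (hf : f.Monic) (B : ℝ) :
    ∃ x < B, 0 < (-1 : ℝ) ^ f.natDegree * f.eval x := by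
  by_cases h0 : f.natDegree = 0
  · refine ⟨B - 1, by linarith, ?_⟩
    rw [hf.natDegree_eq_zero.1 h0]
    simp
  -- The reflected polynomial `(-1)^deg f · f(-X)` is monic, so it tends to `+∞` at `+∞`.
  have hg : ((C ((-1 : ℝ) ^ f.natDegree)) * f.comp (-X)).leadingCoeff = 1 := by
    rw [leadingCoeff_mul, leadingCoeff_C, leadingCoeff_comp (by simp)]
    simp [hf.leadingCoeff, ← mul_pow]
  have hdeg : 0 < ((C ((-1 : ℝ) ^ f.natDegree)) * f.comp (-X)).degree := by
    rw [← natDegree_pos_iff_degree_pos, natDegree_C_mul (by simp), natDegree_comp]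
    simp
    omega
  have ht := tendsto_atTop_of_leadingCoeff_nonneg _ hdeg (by rw [hg]; exact zero_le_one)
  obtain ⟨y, hy1, hy2⟩ :=
    ((ht.eventually_gt_atTop 0).and (Filter.eventually_gt_atTop (-B))).exists
  refine ⟨-y, by linarith, ?_⟩
  simpa using hy1

/-! ### The reduced polynomials and the interlacing of their roots -/

/-- The polynomials `e_m` with `d_{m+1}^B = X e_m`. -/
noncomputable def reducedPolyB : ℕ → ℝ[X]
  | 0 => 1
  | 1 => X + 4
  | m + 2 => (2 * (m : ℝ[X]) + 5) * (X * reducedPolyB (m + 1)) +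
      2 * ((1 - X) * (reducedPolyB (m + 1) + X * derivative (reducedPolyB (m + 1)))) +
      2 * ((m : ℝ[X]) + 2) * (X * reducedPolyB m)

theorem coeff_reducedPolyB (m : ℕ) :
    (reducedPolyB m).coeff m = 1 ∧ ∀ k, m < k → (reducedPolyB m).coeff k = 0 := by
  induction m using Nat.strong_induction_on with
  | _ m ih =>
  match m, ih with
  | 0, _ => exact ⟨by simp [reducedPolyB], fun k hk => by
      simp [reducedPolyB, coeff_one, hk.ne']⟩
  | 1, _ =>
    have h4 : ∀ k, 0 < k → (4 : ℝ[X]).coeff k = 0 := fun k hk => by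
      have : (4 : ℝ[X]) = C 4 := rfl
      rw [this, coeff_C, if_neg (by omega)]
    refine ⟨by simp [reducedPolyB], fun k hk => ?_⟩
    simp [reducedPolyB, h4 k (by omega), coeff_X, hk.ne]
  | m + 2, ih =>
    obtain ⟨a1, a2⟩ := ih (m + 1) (by omega)
    obtain ⟨b1, b2⟩ := ih m (by omega)
    have key : ∀ k, (reducedPolyB (m + 2)).coeff (k + 1) =
        (2 * m + 5) * (reducedPolyB (m + 1)).coeff k +
        2 * ((k + 2) * (reducedPolyB (m + 1)).coeff (k + 1) -
          (k + 1) * (reducedPolyB (m + 1)).coeff k) +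
        2 * (m + 2) * (reducedPolyB m).coeff k := by
      intro k
      have e1 : (2 * (m : ℝ[X]) + 5) = C (2 * (m : ℝ) + 5) := by
        simp only [map_add, map_mul, map_natCast, map_ofNat]
      have e2 : (2 * ((m : ℝ[X]) + 2)) = C (2 * ((m : ℝ) + 2)) := by
        simp only [map_add, map_mul, map_natCast, map_ofNat]
      have e3 : (2 : ℝ[X]) = C 2 := rfl
      rw [reducedPolyB, e1, e2, e3, coeff_add, coeff_add, coeff_C_mul, coeff_C_mul, coeff_C_mul,
        coeff_X_mul, coeff_X_mul, sub_mul, one_mul, coeff_sub, coeff_X_mul, coeff_add, coeff_add,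
        coeff_X_mul, coeff_derivative]
      rcases k with _ | k
      · simp
        ring
      · rw [coeff_X_mul, coeff_derivative]
        push_cast
        ring
    constructor
    -- The leading coefficient is `(2m+5) - 2(m+2) = 1`; `e_m` has too small a degree to contribute.
    · rw [key, a1, a2 _ (by omega), b2 _ (by omega)]
      push_cast
      ring
    · intro k hk
      obtain ⟨k, rfl⟩ : ∃ l, k = l + 1 := ⟨k - 1, by omega⟩
      rw [key, a2 _ (by omega), a2 _ (by omega), b2 _ (by omega)]
      ring

theorem natDegree_reducedPolyB (m : ℕ) : (reducedPolyB m).natDegree = m := by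
  obtain ⟨h1, h2⟩ := coeff_reducedPolyB m
  exact natDegree_eq_of_le_of_coeff_ne_zero (natDegree_le_iff_coeff_eq_zero.2 h2) (by simp [h1])

theorem monic_reducedPolyB (m : ℕ) : (reducedPolyB m).Monic := by
  rw [Monic, leadingCoeff, natDegree_reducedPolyB, (coeff_reducedPolyB m).1]

theorem eval_zero_reducedPolyB_pos (m : ℕ) : 0 < (reducedPolyB m).eval 0 := by
  induction m using Nat.strong_induction_on with
  | _ m ih =>
  match m, ih with
  | 0, _ => simp [reducedPolyB]
  | 1, _ => simp [reducedPolyB]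
  | m + 2, ih => simpa [reducedPolyB] using ih (m + 1) (by omega)

/-- `s` lists the roots of `e_m` increasingly, and `e_{m-1}` alternates in sign along them. -/
structure IsRootList (m : ℕ) (s : Fin m → ℝ) : Prop where
  strictMono : StrictMono s
  neg : ∀ i, s i < 0
  eq_prod : reducedPolyB m = ∏ j, (X - C (s j))
  sign : ∀ i : Fin m, 0 < (-1 : ℝ) ^ (m - 1 - (i : ℕ)) * (reducedPolyB (m - 1)).eval (s i)

theorem IsRootList.exists_succ {m : ℕ} {s : Fin m → ℝ} (hs : IsRootList m s) :
    ∃ t, IsRootList (m + 1) t ∧ ∀ i, t i.castSucc < s i ∧ s i < t i.succ := by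
  rcases m with _ | m
  · refine ⟨fun _ => -4, ⟨fun i j h => ?_, fun i => by norm_num, ?_, fun i => ?_⟩,
      fun i => i.elim0⟩
    · exact absurd h (by omega)
    · rw [reducedPolyB, Fin.prod_univ_succ, Fin.prod_univ_zero, mul_one, C_neg, sub_neg_eq_add]
      rfl
    · simp [reducedPolyB]
  set f := reducedPolyB (m + 2) with hf
  have hroot : ∀ i, (reducedPolyB (m + 1)).eval (s i) = 0 := fun i => by
    rw [hs.eq_prod, eval_prod]
    exact Finset.prod_eq_zero (Finset.mem_univ i) (by simp)
  have hsf : ∀ i : Fin (m + 1), 0 < (-1 : ℝ) ^ (m + 1 - i) * f.eval (s i) := by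
    intro i
    have h1 := pos_neg_one_pow_mul_derivative s hs.strictMono i
    have h2 := hs.sign i
    simp only [Nat.add_sub_cancel] at h2
    rw [← hs.eq_prod] at h1
    have h3 := hs.neg i
    -- All terms of the recurrence containing `e_{m+1}` itself vanish at its root.
    have hev : f.eval (s i) = 2 * s i * ((1 - s i) * (derivative (reducedPolyB (m + 1))).eval (s i)
        + (m + 2) * (reducedPolyB m).eval (s i)) := by
      rw [hf, reducedPolyB]
      simp [hroot]
      ring
    rw [hev, Nat.succ_sub (by omega : (i : ℕ) ≤ m), pow_succ]
    have h4 := mul_pos (by linarith : (0 : ℝ) < 1 - s i) h1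
    have h5 := mul_pos (by positivity : (0 : ℝ) < m + 2) h2
    have h6 := mul_pos (by linarith : (0 : ℝ) < -2 * s i) (add_pos h4 h5)
    linarith
  obtain ⟨x, hx, hxs⟩ := exists_lt_pos_neg_one_pow (monic_reducedPolyB (m + 2)) (s 0)
  rw [natDegree_reducedPolyB] at hxs
  let v : Fin (m + 2) → ℝ := Fin.snoc (α := fun _ => ℝ) s 0
  have hv1 : ∀ i : Fin (m + 1), v i.castSucc = s i := fun i => by simp [v]
  have hv2 : v (Fin.last (m + 1)) = 0 := by simp [v]
  have hv : StrictMono v := by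
    rw [Fin.strictMono_iff_lt_succ]
    intro i
    induction i using Fin.lastCases with
    | last => rw [Fin.succ_last, hv2, hv1]; exact hs.neg _
    | cast i => rw [Fin.succ_castSucc, hv1, hv1]; exact hs.strictMono Fin.castSucc_lt_succ
  -- The test points are `x < s_0 < ⋯ < s_m < 0`; ending at `0` makes every new root negative.
  let u : Fin (m + 3) → ℝ := Fin.cons (α := fun _ => ℝ) x v
  have hu1 : u 0 = x := rfl
  have hu2 : ∀ i : Fin (m + 2), u i.succ = v i := fun i => by simp [u]
  have hu : StrictMono u := by
    rw [Fin.strictMono_iff_lt_succ]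
    intro i
    induction i using Fin.cases with
    | zero =>
      rw [hu2]
      refine lt_of_lt_of_eq hx ?_
      rw [← hv1]
      rfl
    | succ i => rw [← Fin.succ_castSucc, hu2, hu2]; exact hv Fin.castSucc_lt_succ
  obtain ⟨t, ht1, ht2, ht3⟩ := exists_roots_of_alternating (monic_reducedPolyB (m + 2))
    (natDegree_reducedPolyB (m + 2)) u hu (by
      intro k
      induction k using Fin.cases with
      | zero => simpa [hu1] using hxs
      | succ k =>
        rw [hu2]
        induction k using Fin.lastCases with
        | last => rw [hv2]; simpa using eval_zero_reducedPolyB_pos (m + 2)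
        | cast k =>
          rw [hv1]
          have h := hsf k
          have : m + 2 - (k.castSucc.succ : ℕ) = m + 1 - k := by simp
          rwa [this])
  have hint : ∀ i : Fin (m + 1), t i.castSucc < s i ∧ s i < t i.succ := by
    intro i
    have h1 := (ht3 i.castSucc).2
    have h2 := (ht3 i.succ).1
    rw [hu2, hv1] at h1
    rw [← Fin.succ_castSucc, hu2, hv1] at h2
    exact ⟨h1, h2⟩
  refine ⟨t, ⟨ht1, fun i => ?_, ht2, fun i => ?_⟩, hint⟩
  · refine (ht3 i).2.trans_le ?_
    rw [hu2, ← hv2]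
    exact hv.monotone (Fin.le_last i)
  · simp only [Nat.add_sub_cancel]
    -- The sign condition for the next step follows from interlacing: exactly `i` of the old roots
    -- lie below `t i`.
    rw [hs.eq_prod, eval_prod]
    simp only [eval_sub, eval_X, eval_C]
    refine pos_neg_one_pow_mul_prod_sub s (t i) i (by omega) ?_ ?_
    · intro j hj
      exact (hint j).2.trans_le (ht1.monotone (Fin.le_def.2 (by simp; omega)))
    · intro j hj
      exact (ht1.monotone (Fin.le_def.2 (by simpa using hj))).trans_lt (hint j).1

/-- Each list is built from the previous one by recursion, so that consecutive lists interlace by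
construction. -/
theorem exists_rootLists : ∃ s : (m : ℕ) → Fin m → ℝ, (∀ m, IsRootList m (s m)) ∧
    ∀ m (i : Fin m), s (m + 1) i.castSucc < s m i ∧ s m i < s (m + 1) i.succ := by
  have step : ∀ (m : ℕ) (s : {s : Fin m → ℝ // IsRootList m s}),
      ∃ t : {t : Fin (m + 1) → ℝ // IsRootList (m + 1) t},
        ∀ i, t.1 i.castSucc < s.1 i ∧ s.1 i < t.1 i.succ := fun m s => by
    obtain ⟨t, ht, h⟩ := s.2.exists_succ
    exact ⟨⟨t, ht⟩, h⟩
  choose next hnext using step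
  have h0 : IsRootList 0 Fin.elim0 :=
    ⟨fun i => i.elim0, fun i => i.elim0, by simp [reducedPolyB], fun i => i.elim0⟩
  let S : (m : ℕ) → {s : Fin m → ℝ // IsRootList m s} :=
    fun m => Nat.rec ⟨Fin.elim0, h0⟩ next m
  exact ⟨fun m => (S m).1, fun m => (S m).2, fun m => hnext m (S m)⟩

/-! ### Transfer to the derangement polynomials -/

theorem derangementPolyB_succ (m : ℕ) : derangementPolyB (m + 1) = X * reducedPolyB m := by
  induction m using Nat.strong_induction_on with
  | _ m ih =>
  match m, ih with
  | 0, _ => rw [derangementPolyB_one, reducedPolyB, mul_one]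
  | 1, _ =>
    rw [derangementPolyB_add_two, derangementPolyB_one, derangementPolyB_zero, reducedPolyB]
    simp only [derivative_X, Nat.cast_zero]
    ring
  | m + 2, ih =>
    rw [derangementPolyB_add_two, ih (m + 1) (by omega), ih m (by omega), reducedPolyB]
    simp only [derivative_mul, derivative_X]
    push_cast
    ring

theorem mainTheorem4 :
    ∃ r : (n : ℕ) → Fin n → ℝ,
      -- `d_n^B` has degree `n` and `n` distinct real roots `r n 0 < r n 1 < ⋯`, all non-positive
      (∀ n : ℕ, (derangementPolyB n).natDegree = n ∧ StrictMono (r n) ∧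
        (∀ x : ℝ, (derangementPolyB n).IsRoot x ↔ ∃ i : Fin n, r n i = x) ∧
        ∀ i : Fin n, r n i ≤ 0) ∧
      -- the largest root of `d_{n+1}^B` is the root `0`, common to all of these polynomials
      (∀ n : ℕ, r (n + 1) (Fin.last n) = 0) ∧
      -- the roots of `d_n^B` separate those of `d_{n+1}^B`, strictly except at the common root `0`
      (∀ (n : ℕ) (i : Fin n), r (n + 1) i.castSucc < r n i ∧ r n i ≤ r (n + 1) i.succ ∧
        ((i : ℕ) + 1 < n → r n i < r (n + 1) i.succ)) := by
  obtain ⟨s, hs, hint⟩ := exists_rootLists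
  let r : (n : ℕ) → Fin n → ℝ := fun n => match n with
    | 0 => Fin.elim0
    | m + 1 => Fin.snoc (α := fun _ => ℝ) (s m) 0
  have hr1 : ∀ m (i : Fin m), r (m + 1) i.castSucc = s m i := fun m i => by simp [r]
  have hr2 : ∀ m, r (m + 1) (Fin.last m) = 0 := fun m => by simp [r]
  refine ⟨r, fun n => ?_, hr2, fun n i => ?_⟩
  · rcases n with _ | m
    · refine ⟨by rw [derangementPolyB_zero, natDegree_one], fun i => i.elim0, fun x => ?_,
        fun i => i.elim0⟩
      rw [derangementPolyB_zero]
      simp [IsRoot]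
    · have hne : reducedPolyB m ≠ 0 := (monic_reducedPolyB m).ne_zero
      refine ⟨?_, ?_, fun x => ?_, fun i => ?_⟩
      · rw [derangementPolyB_succ, natDegree_X_mul hne, natDegree_reducedPolyB]
      · intro i j hij
        induction j using Fin.lastCases with
        | last =>
          obtain ⟨i, rfl⟩ := Fin.exists_castSucc_eq.2 hij.ne
          rw [hr1, hr2]
          exact (hs m).neg i
        | cast j =>
          obtain ⟨i, rfl⟩ := Fin.exists_castSucc_eq.2 (hij.trans (Fin.castSucc_lt_last j)).ne
          rw [hr1, hr1]
          exact (hs m).strictMono hij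
      · rw [derangementPolyB_succ, (hs m).eq_prod, IsRoot, eval_mul, eval_X, mul_eq_zero,
          eval_prod, Finset.prod_eq_zero_iff, Fin.exists_fin_succ']
        simp only [hr1, hr2, Finset.mem_univ, true_and, eval_sub, eval_X, eval_C, sub_eq_zero]
        simp only [eq_comm, or_comm]
      · induction i using Fin.lastCases with
        | last => exact (hr2 m).le
        | cast i => rw [hr1]; exact ((hs m).neg i).le
  · rcases n with _ | m
    · exact i.elim0
    · have hsucc : ∀ i : Fin m, r (m + 1) i.castSucc < r (m + 2) i.castSucc.succ := fun i => by
        rw [Fin.succ_castSucc, hr1, hr1]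
        exact (hint m i).2
      induction i using Fin.lastCases with
      | last =>
        refine ⟨?_, ?_, fun h => ?_⟩
        · rw [hr1, hr2]
          exact (hs (m + 1)).neg _
        · rw [Fin.succ_last, hr2, hr2]
        · simp at h
      | cast i =>
        refine ⟨?_, (hsucc i).le, fun _ => hsucc i⟩
        rw [hr1, hr1]
        exact (hint m i).1
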